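/- Let $\mathbb U$ be a standard universe, i.e. a transitive class of sets closed under unordered pairs, unions and power sets (for instance the class of all sets), in which $\mathbb R$ and all spaces considered are (coded as) elements. Let ${}^{*}\mathbb U$ be a nonstandard universe: a $|\mathbb U|^{+}$-saturated elementary extension of $(\mathbb U,\in)$ in the language of set theory, with embedding $A\mapsto{}^{*}A$. Let $X$ be a uniform space in $\mathbb U$. Standard notions. For an entourage $V$ of $X$, a $V$-chain of length $n$ from $x$ to $y$ is a sequence of $n$ points of $X$ with first term $x$, last term $y$ and every pair of consecutive terms in $V$. $X$ is *chain-connected* if for every entourage $V$ any two points of $X$ are joined by a $V$-chain. A subset $B\subseteq X$ is *bounded* (in the sense of Hu) if for every entourage $V$ of $X$ there is an $n\in\mathbb N$ such that any two points of $B$ are joined by a $V$-chain of length $n$ in $X$; $X$ is *bounded in itself* if $B=X$ is bounded. Nonstandard notions. For points $a,b$ of ${}^{*}X$ write $a\approx b$ if $(a,b)\in{}^{*}V$ for every entourage $V$ of $X$, and similarly on ${}^{*}\mathbb R$. For a hyperreal $T\ge 0$ let ${}^{*}[0,T]=\{t\in{}^{*}\mathbb R: 0\le t\le T\}$. An internal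 map $\gamma:{}^{*}[0,T]\to{}^{*}X$ is *S-continuous* if $s\approx t$ implies $\gamma(s)\approx\gamma(t)$ for all $s,t\in{}^{*}[0,T]$. A subset $B\subseteq X$ is *$S_T$-bounded* if for all $x,y\in{}^{*}B$ there is an S-continuous internal map $\gamma:{}^{*}[0,T]\to{}^{*}X$ with $\gamma(0)=x$ and $\gamma(T)=y$; $B$ is *$S_\bullet$-bounded* if it is $S_T$-bounded for some hyperreal $T\ge 0$. $X$ is *$S_T$-connected* if for all $x,y\in{}^{*}X$ there is such a $\gamma$ with $\gamma(0)=x$ and $\gamma(T)=y$, and *$S_\bullet$-connected* if it is $S_T$-connected for some hyperreal $T\ge0$. $X$ is *$S_\infty$-connected* if for all $x,y\in{}^{*}X$ there are a hyperreal $T\ge 0$, which may depend on $x$ and $y$, and such a $\gamma$ with $\gamma(0)=x$ and $\gamma(T)=y$. Then: 1. $X$ is bounded in itself if and only if $X$ is $S_\bullet$-connected; 2. for every subset $B\subseteq X$, $B$ is bounded in $X$ if and only if $B$ is $S_\bullet$-bounded in $X$; 3. $X$ is chain-connected if and only if $X$ is $S_\infty$-connected. -/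

import Mathlib

open Set
open scoped Uniformity Cardinal FirstOrder

universe u v w

/-! ### The language of set theory and saturation -/

/-- The only symbol of the language of set theory: a binary relation symbol. -/
inductive MemSymbol : ℕ → Type
  | mem : MemSymbol 2

/-- The first-order language `{∈}` of set theory. -/
def setLanguage : FirstOrder.Language.{0, 0} := ⟨fun _ => Empty, MemSymbol⟩

/-- The membership relation `a ∈ b` of a structure for the language of set theory. -/
def IsMem {M : Type*} [setLanguage.Structure M] (a b : M) : Prop :=
  FirstOrder.Language.Structure.RelMap (L := setLanguage) (n := 2) MemSymbol.mem ![a, b]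

/-- `p` is the Kuratowski pair `{{a}, {a, b}}` in the sense of the structure `M`. -/
def IsPair {M : Type*} [setLanguage.Structure M] (p a b : M) : Prop :=
  ∀ z, IsMem z p ↔ (∀ y, IsMem y z ↔ y = a) ∨ (∀ y, IsMem y z ↔ y = a ∨ y = b)

/-- `M` is `κ`-saturated: every set of formulas in one free variable, with fewer than `κ`
parameters from `M`, that is finitely satisfiable in `M` is satisfied by an element of `M`. -/
def IsSaturated (L : FirstOrder.Language.{0, 0}) (κ : Cardinal.{v}) (M : Type w) [L.Structure M] : Prop :=
  ∀ A : Set M, Cardinal.lift.{v} #A < Cardinal.lift.{w} κ →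
    ∀ Φ : Set (L[[A]].Formula Unit),
      (∀ Ψ : Finset (L[[A]].Formula Unit), (Ψ : Set (L[[A]].Formula Unit)) ⊆ Φ →
        ∃ x : M, ∀ φ ∈ Ψ, φ.Realize (fun _ => x)) →
      ∃ x : M, ∀ φ ∈ Φ, φ.Realize (fun _ => x)

/-! ### The standard universe -/

/-- A standard universe: a transitive class of sets that is closed under unordered pairs, unions
and power sets. (The class of all sets is one; so is every `V_α` with `α` a limit ordinal.) -/
structure StandardUniverse where
  carrier : Set ZFSet.{u}
  mem_of_mem : ∀ x ∈ carrier, ∀ y ∈ x, y ∈ carrier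
  pair_mem : ∀ x ∈ carrier, ∀ y ∈ carrier, ({x, y} : ZFSet.{u}) ∈ carrier
  sUnion_mem : ∀ x ∈ carrier, ZFSet.sUnion x ∈ carrier
  powerset_mem : ∀ x ∈ carrier, ZFSet.powerset x ∈ carrier

/-- The elements of a standard universe, as a type. -/
def StandardUniverse.Elem (𝕌 : StandardUniverse.{u}) : Type (u + 1) := {x // x ∈ 𝕌.carrier}

/-- A standard universe with its true membership relation. -/
instance (𝕌 : StandardUniverse.{u}) : setLanguage.Structure 𝕌.Elem where
  funMap f _ := f.elim
  RelMap r :=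
    match r with
    | MemSymbol.mem => fun x => (x 0).1 ∈ (x 1).1

theorem StandardUniverse.subset_mem (𝕌 : StandardUniverse.{u}) {x y : ZFSet.{u}}
    (hx : x ∈ 𝕌.carrier) (hy : y ⊆ x) : y ∈ 𝕌.carrier :=
  𝕌.mem_of_mem _ (𝕌.powerset_mem x hx) y (ZFSet.mem_powerset.2 hy)

theorem StandardUniverse.prod_mem (𝕌 : StandardUniverse.{u}) {x y : ZFSet.{u}}
    (hx : x ∈ 𝕌.carrier) (hy : y ∈ 𝕌.carrier) : ZFSet.prod x y ∈ 𝕌.carrier := by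
  have h : x ∪ y ∈ 𝕌.carrier := 𝕌.sUnion_mem _ (𝕌.pair_mem x hx y hy)
  refine 𝕌.subset_mem (𝕌.powerset_mem _ (𝕌.powerset_mem _ h)) ?_
  intro z hz
  obtain ⟨a, ha, b, hb, rfl⟩ := ZFSet.mem_prod.1 hz
  rw [ZFSet.mem_powerset]
  intro s hs
  rw [ZFSet.mem_powerset]
  intro t ht
  rw [ZFSet.mem_union]
  simp only [ZFSet.pair, ZFSet.mem_pair] at hs
  rcases hs with rfl | rfl
  · rw [ZFSet.mem_singleton] at ht
    exact Or.inl (ht ▸ ha)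
  · rw [ZFSet.mem_pair] at ht
    rcases ht with rfl | rfl
    · exact Or.inl ha
    · exact Or.inr hb

/-- An implementation of the type `α` as a set belonging to the universe `𝕌`:
a bijection of `α` onto (the elements of) a set `carrier ∈ 𝕌`. -/
structure Coding (𝕌 : StandardUniverse.{u}) (α : Type v) where
  toFun : α → ZFSet.{u}
  injective : Function.Injective toFun
  carrier : ZFSet.{u}
  carrier_mem : carrier ∈ 𝕌.carrier
  mem_carrier : ∀ z, z ∈ carrier ↔ ∃ a, toFun a = z

namespace Coding

variable {𝕌 : StandardUniverse.{u}} {α : Type v} {β : Type w}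

/-- The point `a : α` as an element of `𝕌`. -/
def point (c : Coding 𝕌 α) (a : α) : 𝕌.Elem :=
  ⟨c.toFun a, 𝕌.mem_of_mem _ c.carrier_mem _ ((c.mem_carrier _).2 ⟨a, rfl⟩)⟩

/-- The subset `S` of `α` as an element of `𝕌`. -/
noncomputable def set (c : Coding 𝕌 α) (S : Set α) : 𝕌.Elem :=
  ⟨ZFSet.sep (fun z => ∃ a ∈ S, c.toFun a = z) c.carrier,
    𝕌.subset_mem c.carrier_mem fun _ h => (ZFSet.mem_sep.1 h).1⟩

/-- The relation `R` between `α` and `β`, a set of ordered pairs, as an element of `𝕌`. -/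
noncomputable def rel (c : Coding 𝕌 α) (d : Coding 𝕌 β) (R : α → β → Prop) : 𝕌.Elem :=
  ⟨ZFSet.sep (fun z => ∃ a b, R a b ∧ ZFSet.pair (c.toFun a) (d.toFun b) = z)
      (ZFSet.prod c.carrier d.carrier),
    𝕌.subset_mem (𝕌.prod_mem c.carrier_mem d.carrier_mem) fun _ h => (ZFSet.mem_sep.1 h).1⟩

end Coding

/-! ### The nonstandard universe

`N` is the nonstandard universe and `j : 𝕌 ↪ₑ N`, an elementary embedding in the language of set
theory, is the map `A ↦ *A`. -/

section Nonstandard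

variable {𝕌 : StandardUniverse.{u}} {N : Type w} [setLanguage.Structure N]
  (j : 𝕌.Elem ↪ₑ[setLanguage] N)

/-- The nonstandard extension `*S` of a subset `S` of `α`. -/
def starSet {α : Type*} (c : Coding 𝕌 α) (S : Set α) : Set N := {a | IsMem a (j (c.set S))}

/-- The ordered pair `(a, b)` is an element of the internal set `g`. -/
def PairMem (a b g : N) : Prop := ∃ p, IsMem p g ∧ IsPair p a b

/-- The nonstandard extension `*R` of a relation `R` between `α` and `β`. -/
def StarRel {α β : Type*} (c : Coding 𝕌 α) (d : Coding 𝕌 β) (R : α → β → Prop) (a b : N) : Prop :=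
  PairMem a b (j (c.rel d R))

/-- Infinite closeness `a ≈ b` of points of `*X`: `(a, b) ∈ *V` for every entourage `V` of `X`. -/
def InfClose {X : Type*} [UniformSpace X] (c : Coding 𝕌 X) (a b : N) : Prop :=
  ∀ V ∈ 𝓤 X, StarRel j c c (fun x y => (x, y) ∈ V) a b

/-- The set of hyperreal numbers `T ≥ 0`. -/
def nonnegHyperreals (r : Coding 𝕌 ℝ) : Set N :=
  {T | T ∈ starSet j r univ ∧ StarRel j r r (· ≤ ·) (j (r.point 0)) T}

/-- The hyperreal interval `*[0, T]`, where `T` is hyperreal. -/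
def hyperInterval (r : Coding 𝕌 ℝ) (T : N) : Set N :=
  {t | t ∈ starSet j r univ ∧ StarRel j r r (· ≤ ·) (j (r.point 0)) t ∧ StarRel j r r (· ≤ ·) t T}

/-- The map `γ : A → B` is internal: its graph is cut out by an internal set. -/
def IsInternalMap (γ : N → N) (A B : Set N) : Prop :=
  ∃ g : N, ∀ a ∈ A, ∀ b ∈ B, PairMem a b g ↔ γ a = b

/-- `γ : *[0, T] → *X` is an S-continuous (internal) map with `γ(0) = x` and `γ(T) = y`.
Only the values of `γ` on `*[0, T]` matter. -/
structure IsSPath {X : Type*} [UniformSpace X] (r : Coding 𝕌 ℝ) (c : Coding 𝕌 X) (T x y : N)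
    (γ : N → N) : Prop where
  mapsTo : MapsTo γ (hyperInterval j r T) (starSet j c univ)
  internal : IsInternalMap γ (hyperInterval j r T) (starSet j c univ)
  s_continuous : ∀ s ∈ hyperInterval j r T, ∀ t ∈ hyperInterval j r T,
    InfClose j r s t → InfClose j c (γ s) (γ t)
  source : γ (j (r.point 0)) = x
  target : γ T = y

/-- `B ⊆ X` is `S_T`-bounded. -/
def IsSBoundedAt {X : Type*} [UniformSpace X] (r : Coding 𝕌 ℝ) (c : Coding 𝕌 X) (T : N)
    (B : Set X) : Prop :=
  ∀ x ∈ starSet j c B, ∀ y ∈ starSet j c B, ∃ γ : N → N, IsSPath j r c T x y γ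

/-- `B ⊆ X` is `S_•`-bounded: it is `S_T`-bounded for some hyperreal `T ≥ 0`. -/
def IsSBounded {X : Type*} [UniformSpace X] (r : Coding 𝕌 ℝ) (c : Coding 𝕌 X) (B : Set X) : Prop :=
  ∃ T ∈ nonnegHyperreals j r, IsSBoundedAt j r c T B

/-- `X` is `S_T`-connected. -/
def IsSConnectedAt {X : Type*} [UniformSpace X] (r : Coding 𝕌 ℝ) (c : Coding 𝕌 X) (T : N) : Prop :=
  ∀ x ∈ starSet j c univ, ∀ y ∈ starSet j c univ, ∃ γ : N → N, IsSPath j r c T x y γ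

/-- `X` is `S_•`-connected: it is `S_T`-connected for some hyperreal `T ≥ 0`. -/
def IsSConnected {X : Type*} [UniformSpace X] (r : Coding 𝕌 ℝ) (c : Coding 𝕌 X) : Prop :=
  ∃ T ∈ nonnegHyperreals j r, IsSConnectedAt j r c T

/-- `X` is `S_∞`-connected: the length `T` may depend on the two points. -/
def IsSInftyConnected {X : Type*} [UniformSpace X] (r : Coding 𝕌 ℝ) (c : Coding 𝕌 X) : Prop :=
  ∀ x ∈ starSet j c univ, ∀ y ∈ starSet j c univ,
    ∃ T ∈ nonnegHyperreals j r, ∃ γ : N → N, IsSPath j r c T x y γ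

end Nonstandard

/-! ### Chains and boundedness in a uniform space -/

/-- `l` is a `V`-chain from `x` to `y`: a finite sequence of points, starting at `x` and ending at
`y`, with consecutive points related by `V`. Its length is the number of its points. -/
def IsChainFromTo {X : Type*} (V : Set (X × X)) (x y : X) (l : List X) : Prop :=
  l.IsChain (fun a b => (a, b) ∈ V) ∧ l.head? = some x ∧ l.getLast? = some y

/-- `X` is chain-connected. -/
def IsChainConnected (X : Type*) [UniformSpace X] : Prop :=
  ∀ V ∈ 𝓤 X, ∀ x y : X, ∃ l : List X, IsChainFromTo V x y l

/-- `B` is bounded in the uniform space `X` in the sense of Hu. -/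
def IsHuBounded {X : Type*} [UniformSpace X] (B : Set X) : Prop :=
  ∀ V ∈ 𝓤 X, ∃ n : ℕ, ∀ x ∈ B, ∀ y ∈ B, ∃ l : List X, l.length = n ∧ IsChainFromTo V x y l

/-!
For an entourage `V` of `X` and an entourage `W` of the real line, consider maps
`f : [0, T] → X` that take `W`-close times to `V`-close points (`IsFinePath`). In the standard
universe such maps are the same as chains, up to a change of `W`: a chain is a step function, with
`W` the set of times at distance less than `1` (`IsChainFromTo.exists_isFinePath`), and sampling a
map at equidistant, sufficiently close times gives a chain whose length depends only on `T` and `W`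
(`exists_length_of_isFinePath`). So boundedness of `B` says that for every `V` there are `T` and `W`
such that all points of `B` are joined by fine paths on `[0, T]`, where it makes no difference
whether `W` is fixed beforehand. In chain-connectedness, `T` may depend on the points. Both
properties of `V` and `W` are first-order (`SetFormula.uniformlyJoined`,
`SetFormula.pointwiseJoined`).

Saturation gives `exists_infinitesimal_relation`: a first-order property of all entourages of a
uniform space is shared by some internal relation that implies infinite closeness. It is used in
both directions.

* From chains to S-continuous paths, it is applied to the entourages `V` of `X`, with `W` fixed.
  Infinitely close times have distance less than `1`, so an internal map that takes such times to
  points in an infinitesimal relation is S-continuous (`exists_isSPath_of_joined`).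
* From S-continuous paths to chains, `V` is fixed. If the standard statement failed for every
  entourage `W` of the real line, it would fail for an infinitesimal relation in place of `W`, on
  hyperreal intervals; but an S-continuous path satisfies it there (`joined_of_isSPath`).
-/

/-! ### First-order formulas about pairs and fine paths -/

namespace SetFormula

open FirstOrder.Language

variable {α : Type*} {n : ℕ}

/-- A variable of a formula in context `n`, as a variable in context `n + 1`. -/
def up (i : α ⊕ Fin n) : α ⊕ Fin (n + 1) := Sum.map id Fin.castSucc i

/-- The variable bound by the innermost of `n + 1` quantifiers. -/
def new : α ⊕ Fin (n + 1) := Sum.inr (Fin.last n)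

/-- The formula `i ∈ k`. -/
def mem (i k : α ⊕ Fin n) : setLanguage.BoundedFormula α n :=
  Relations.boundedFormula₂ (L := setLanguage) MemSymbol.mem (Term.var i) (Term.var k)

/-- The formula `i = k`. -/
def eq (i k : α ⊕ Fin n) : setLanguage.BoundedFormula α n :=
  (Term.var i).bdEqual (Term.var k)

/-- The formula `p = {{a}, {a, b}}`. -/
def isPair (p a b : α ⊕ Fin n) : setLanguage.BoundedFormula α n :=
  ∀' (mem new (up p) ⇔
    (∀' (mem new (up new) ⇔ eq new (up (up a))) ⊔
      ∀' (mem new (up new) ⇔ (eq new (up (up a)) ⊔ eq new (up (up b))))))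

/-- The formula `(a, b) ∈ g`. -/
def pairMem (a b g : α ⊕ Fin n) : setLanguage.BoundedFormula α n :=
  ∃' (mem new (up g) ⊓ isPair new (up a) (up b))

variable {M : Type*} {v : α → M} {xs : Fin n → M}

@[simp]
theorem val_up (i : α ⊕ Fin n) (a : M) :
    Sum.elim v (Fin.snoc xs a : Fin (n + 1) → M) (up i) = Sum.elim v xs i := by
  cases i <;> simp [up]

@[simp]
theorem val_new (a : M) : Sum.elim v (Fin.snoc xs a : Fin (n + 1) → M) new = a := by
  simp [new]

variable [setLanguage.Structure M]

@[simp]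
theorem realize_mem {i k : α ⊕ Fin n} :
    (mem i k).Realize v xs ↔ IsMem (Sum.elim v xs i) (Sum.elim v xs k) :=
  BoundedFormula.realize_rel₂

@[simp]
theorem realize_eq {i k : α ⊕ Fin n} :
    (eq i k).Realize v xs ↔ Sum.elim v xs i = Sum.elim v xs k := by
  simp [eq]

@[simp]
theorem realize_isPair {p a b : α ⊕ Fin n} : (isPair p a b).Realize v xs ↔
    IsPair (Sum.elim v xs p) (Sum.elim v xs a) (Sum.elim v xs b) := by
  simp [isPair, IsPair]

@[simp]
theorem realize_pairMem {a b g : α ⊕ Fin n} : (pairMem a b g).Realize v xs ↔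
    PairMem (Sum.elim v xs a) (Sum.elim v xs b) (Sum.elim v xs g) := by
  simp [pairMem, PairMem]

end SetFormula

/-- The parameters of a statement about paths: a set `times` with an order relation `le` and a
starting time `zero`, a set `space` in which paths run, and two relations, `close` between times
and `fine` between points. The parameters are elements of a structure for the language of set
theory, or else variables of a formula that stand for such elements. -/
structure PathData (M : Type*) where
  times : M
  zero : M
  le : M
  space : M
  close : M
  fine : M

namespace PathData

/-- The image of the parameters under a map. -/
def map {M M' : Type*} (f : M → M') (P : PathData M) : PathData M' :=
  ⟨f P.times, f P.zero, f P.le, f P.space, f P.close, f P.fine⟩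

variable {M : Type*} [setLanguage.Structure M]

/-- The time `t` lies between `zero` and `T`. -/
def InInterval (P : PathData M) (T t : M) : Prop :=
  IsMem t P.times ∧ PairMem P.zero t P.le ∧ PairMem t T P.le

/-- The set `g` is, on times from `zero` to `T` and points of `space`, the graph of a map that
takes `close` times to `fine` points. -/
def IsFineGraph (P : PathData M) (T g : M) : Prop :=
  (∀ t, P.InInterval T t → ∃ b, IsMem b P.space ∧
    ∀ b', IsMem b' P.space → (PairMem t b' g ↔ b' = b)) ∧
  ∀ s t, P.InInterval T s → P.InInterval T t → PairMem s t P.close →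
    ∀ a b, IsMem a P.space → IsMem b P.space → PairMem s a g → PairMem t b g → PairMem a b P.fine

/-- The points `x` and `y` are joined by a map with `IsFineGraph`. -/
def Joined (P : PathData M) (T x y : M) : Prop :=
  IsMem x P.space ∧ IsMem y P.space ∧
    ∃ g, P.IsFineGraph T g ∧ PairMem P.zero x g ∧ PairMem T y g

/-- All points of `B` are joined by maps as in `Joined` on one and the same interval. -/
def UniformlyJoined (P : PathData M) (B : M) : Prop :=
  ∃ T, (IsMem T P.times ∧ PairMem P.zero T P.le) ∧
    ∀ x, IsMem x B → ∀ y, IsMem y B → P.Joined T x y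

/-- All points of `B` are joined by maps as in `Joined`, on intervals that depend on the points. -/
def PointwiseJoined (P : PathData M) (B : M) : Prop :=
  ∀ x, IsMem x B → ∀ y, IsMem y B →
    ∃ T, (IsMem T P.times ∧ PairMem P.zero T P.le) ∧ P.Joined T x y

end PathData

namespace SetFormula

open FirstOrder.Language

variable {α : Type*} {n : ℕ}

/-- The formula for `PathData.InInterval`. -/
def inInterval (P : PathData (α ⊕ Fin n)) (T t : α ⊕ Fin n) : setLanguage.BoundedFormula α n :=
  mem t P.times ⊓ (pairMem P.zero t P.le ⊓ pairMem t T P.le)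

/-- The formula for `PathData.IsFineGraph`. -/
def isFineGraph (P : PathData (α ⊕ Fin n)) (T g : α ⊕ Fin n) : setLanguage.BoundedFormula α n :=
  ∀' (inInterval (P.map up) (up T) new ⟹
    ∃' (mem new (up (up P.space)) ⊓
      ∀' (mem new (up (up (up P.space))) ⟹
        (pairMem (up (up new)) new (up (up (up g))) ⇔ eq new (up new))))) ⊓
  ∀' ∀' (inInterval ((P.map up).map up) (up (up T)) (up new) ⟹
    inInterval ((P.map up).map up) (up (up T)) new ⟹
    pairMem (up new) new (up (up P.close)) ⟹
    ∀' ∀' (mem (up new) (up (up (up (up P.space)))) ⟹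
      mem new (up (up (up (up P.space)))) ⟹
      pairMem (up (up (up new))) (up new) (up (up (up (up g)))) ⟹
      pairMem (up (up new)) new (up (up (up (up g)))) ⟹
      pairMem (up new) new (up (up (up (up P.fine))))))

/-- The formula for `PathData.Joined`. -/
def joined (P : PathData (α ⊕ Fin n)) (T x y : α ⊕ Fin n) : setLanguage.BoundedFormula α n :=
  mem x P.space ⊓ (mem y P.space ⊓
    ∃' (isFineGraph (P.map up) (up T) new ⊓
      (pairMem (up P.zero) (up x) new ⊓ pairMem (up T) (up y) new)))

/-- The formula for `PathData.UniformlyJoined`. -/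
def uniformlyJoined (P : PathData (α ⊕ Fin n)) (B : α ⊕ Fin n) :
    setLanguage.BoundedFormula α n :=
  ∃' ((mem new (up P.times) ⊓ pairMem (up P.zero) new (up P.le)) ⊓
    ∀' (mem new (up (up B)) ⟹ ∀' (mem new (up (up (up B))) ⟹
      joined (((P.map up).map up).map up) (up (up new)) (up new) new)))

/-- The formula for `PathData.PointwiseJoined`. -/
def pointwiseJoined (P : PathData (α ⊕ Fin n)) (B : α ⊕ Fin n) :
    setLanguage.BoundedFormula α n :=
  ∀' (mem new (up B) ⟹ ∀' (mem new (up (up B)) ⟹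
    ∃' ((mem new (up (up (up P.times))) ⊓
        pairMem (up (up (up P.zero))) new (up (up (up P.le)))) ⊓
      joined (((P.map up).map up).map up) new (up (up new)) (up new))))

variable {M : Type*} {v : α → M} {xs : Fin n → M}

@[simp]
theorem map_val_map_up (P : PathData (α ⊕ Fin n)) (a : M) :
    (P.map up).map (Sum.elim v (Fin.snoc xs a : Fin (n + 1) → M)) = P.map (Sum.elim v xs) := by
  simp [PathData.map]

variable [setLanguage.Structure M]

@[simp]
theorem realize_inInterval {P : PathData (α ⊕ Fin n)} {T t : α ⊕ Fin n} :
    (inInterval P T t).Realize v xs ↔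
      (P.map (Sum.elim v xs)).InInterval (Sum.elim v xs T) (Sum.elim v xs t) := by
  simp [inInterval, PathData.InInterval, PathData.map]

@[simp]
theorem realize_isFineGraph {P : PathData (α ⊕ Fin n)} {T g : α ⊕ Fin n} :
    (isFineGraph P T g).Realize v xs ↔
      (P.map (Sum.elim v xs)).IsFineGraph (Sum.elim v xs T) (Sum.elim v xs g) := by
  simp [isFineGraph, PathData.IsFineGraph]
  simp [PathData.map]

@[simp]
theorem realize_joined {P : PathData (α ⊕ Fin n)} {T x y : α ⊕ Fin n} :
    (joined P T x y).Realize v xs ↔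
      (P.map (Sum.elim v xs)).Joined (Sum.elim v xs T) (Sum.elim v xs x) (Sum.elim v xs y) := by
  simp [joined, PathData.Joined]
  simp [PathData.map]

@[simp]
theorem realize_uniformlyJoined {P : PathData (α ⊕ Fin n)} {B : α ⊕ Fin n} :
    (uniformlyJoined P B).Realize v xs ↔
      (P.map (Sum.elim v xs)).UniformlyJoined (Sum.elim v xs B) := by
  simp [uniformlyJoined, PathData.UniformlyJoined]
  simp [PathData.map]

@[simp]
theorem realize_pointwiseJoined {P : PathData (α ⊕ Fin n)} {B : α ⊕ Fin n} :
    (pointwiseJoined P B).Realize v xs ↔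
      (P.map (Sum.elim v xs)).PointwiseJoined (Sum.elim v xs B) := by
  simp [pointwiseJoined, PathData.PointwiseJoined]
  simp [PathData.map]

end SetFormula

/-! ### Transfer and saturation -/

section Saturation

open FirstOrder.Language

variable {𝕌 : StandardUniverse.{u}} {N : Type w} [setLanguage.Structure N]
  (j : 𝕌.Elem ↪ₑ[setLanguage] N)

/-- Saturation for formulas with parameters from the standard universe. -/
theorem exists_realize_of_finitely_realizable
    (hN : IsSaturated setLanguage (Order.succ #𝕌.Elem) N)
    (Φ : Set (setLanguage.Formula (𝕌.Elem ⊕ Unit)))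
    (hΦ : ∀ Ψ : Finset (setLanguage.Formula (𝕌.Elem ⊕ Unit)),
      (Ψ : Set (setLanguage.Formula (𝕌.Elem ⊕ Unit))) ⊆ Φ →
        ∃ x : 𝕌.Elem, ∀ φ ∈ Ψ, φ.Realize (Sum.elim id fun _ => x)) :
    ∃ x : N, ∀ φ ∈ Φ, φ.Realize (Sum.elim j fun _ => x) := by
  classical
  let A : Set N := range j
  let name : 𝕌.Elem → A := fun a => ⟨j a, mem_range_self a⟩
  let m : setLanguage.Formula (𝕌.Elem ⊕ Unit) → setLanguage[[A]].Formula Unit := fun φ =>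
    BoundedFormula.constantsVarsEquiv.symm (Formula.relabel (Sum.map name id) φ)
  have hm : ∀ (φ : setLanguage.Formula (𝕌.Elem ⊕ Unit)) (x : N),
      (m φ).Realize (fun _ => x) ↔ φ.Realize (Sum.elim j fun _ => x) := by
    intro φ x
    have h := BoundedFormula.realize_constantsVarsEquiv (L := setLanguage) (φ := m φ)
      (v := fun _ : Unit => x) (xs := default)
    simp only [m, Equiv.apply_symm_apply] at h
    refine h.symm.trans ?_
    refine (Formula.realize_relabel (φ := φ)).trans ?_
    have e : (Sum.elim (fun a : A => ((setLanguage.con a : setLanguage[[A]].Constants) : N))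
        (fun _ : Unit => x)) ∘ Sum.map name id = Sum.elim j fun _ => x := by
      funext i
      cases i <;> simp [name]
    rw [e]
  have hA : Cardinal.lift.{u + 1} #A < Cardinal.lift.{w} (Order.succ #𝕌.Elem) :=
    Cardinal.mk_range_le_lift.trans_lt (Cardinal.lift_lt.2 (Order.lt_succ _))
  obtain ⟨x, hx⟩ := hN A hA (m '' Φ) (by
    intro Ψ hΨ
    obtain ⟨Ψ', hΨ', rfl⟩ := Finset.subset_set_image_iff.1 hΨ
    obtain ⟨x, hx⟩ := hΦ Ψ' hΨ'
    refine ⟨j x, fun φ hφ => ?_⟩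
    obtain ⟨ψ, hψ, rfl⟩ := Finset.mem_image.1 hφ
    rw [hm]
    have h := (j.map_formula ψ (Sum.elim id fun _ => x)).2 (hx ψ hψ)
    convert h using 1
    funext i
    cases i <;> rfl)
  exact ⟨x, fun φ hφ => (hm φ x).1 (hx _ (mem_image_of_mem m hφ))⟩

end Saturation

section MemStandard

variable {𝕌 : StandardUniverse.{u}} {α : Type*} {β : Type*}

theorem isMem_iff_mem (a b : 𝕌.Elem) : IsMem a b ↔ a.1 ∈ b.1 := Iff.rfl

theorem Coding.isMem_set_iff_val (c : Coding 𝕌 α) (S : Set α) (z : 𝕌.Elem) :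
    IsMem z (c.set S) ↔ z.1 ∈ c.carrier ∧ ∃ a ∈ S, c.toFun a = z.1 := by
  rw [isMem_iff_mem, Coding.set, ZFSet.mem_sep]

theorem Coding.isMem_rel_iff_val (c : Coding 𝕌 α) (d : Coding 𝕌 β) (R : α → β → Prop)
    (z : 𝕌.Elem) : IsMem z (c.rel d R) ↔ z.1 ∈ ZFSet.prod c.carrier d.carrier ∧
      ∃ a b, R a b ∧ ZFSet.pair (c.toFun a) (d.toFun b) = z.1 := by
  rw [isMem_iff_mem, Coding.rel, ZFSet.mem_sep]

end MemStandard

section Transfer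

open FirstOrder.Language

variable {𝕌 : StandardUniverse.{u}} {N : Type w} [setLanguage.Structure N]
  (j : 𝕌.Elem ↪ₑ[setLanguage] N)

/-- If a property `φ` holds of all entourages, then it holds of an internal relation that is
contained in the extensions of all of them. -/
theorem exists_infinitesimal_relation (hN : IsSaturated setLanguage (Order.succ #𝕌.Elem) N)
    {X : Type*} [UniformSpace X] (c : Coding 𝕌 X) (φ : setLanguage.Formula (𝕌.Elem ⊕ Unit))
    (h : ∀ V ∈ 𝓤 X, φ.Realize (Sum.elim id fun _ => c.rel c fun x y => (x, y) ∈ V)) :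
    ∃ v : N, φ.Realize (Sum.elim j fun _ => v) ∧
      ∀ a b, PairMem a b v → InfClose j c a b := by
  let ent : Set (X × X) → 𝕌.Elem := fun V => c.rel c fun x y => (x, y) ∈ V
  let sub : Set (X × X) → setLanguage.Formula (𝕌.Elem ⊕ Unit) := fun V =>
    ∀' (SetFormula.mem SetFormula.new (SetFormula.up (.inl (.inr ()))) ⟹
      SetFormula.mem SetFormula.new (SetFormula.up (.inl (.inl (ent V)))))
  obtain ⟨v, hv⟩ := exists_realize_of_finitely_realizable j hN (insert φ (sub '' (𝓤 X).sets)) (by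
    intro Ψ hΨ
    -- Finitely many of the conditions hold of every sufficiently small entourage.
    have key : ∀ᶠ V in (𝓤 X).smallSets, ∀ ψ ∈ Ψ, V ∈ 𝓤 X →
        ψ.Realize (Sum.elim id fun _ => ent V) := by
      refine (Filter.eventually_all_finset Ψ).2 fun ψ hψ => ?_
      rcases hΨ hψ with rfl | ⟨V, hV, rfl⟩
      · exact Filter.Eventually.of_forall h
      · refine Filter.eventually_smallSets.2 ⟨V, hV, fun V' hV' _ => ?_⟩
        simp only [sub, Formula.Realize, BoundedFormula.realize_all, BoundedFormula.realize_imp,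
          SetFormula.realize_mem, SetFormula.val_new, SetFormula.val_up, Sum.elim_inl,
          Sum.elim_inr]
        intro p hp
        obtain ⟨hp, a, b, hab, e⟩ := (c.isMem_rel_iff_val c _ p).1 hp
        exact (c.isMem_rel_iff_val c _ p).2 ⟨hp, a, b, hV' hab, e⟩
    obtain ⟨V, hV, hV'⟩ := Filter.eventually_smallSets.1 key
    exact ⟨ent V, fun ψ hψ => hV' V Subset.rfl ψ hψ hV⟩)
  refine ⟨v, hv _ (mem_insert _ _), fun a b ⟨p, hp, hab⟩ V hV => ?_⟩
  have := hv _ (mem_insert_of_mem _ (mem_image_of_mem sub hV))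
  simp only [sub, Formula.Realize, BoundedFormula.realize_all, BoundedFormula.realize_imp,
    SetFormula.realize_mem, SetFormula.val_new, SetFormula.val_up, Sum.elim_inl,
    Sum.elim_inr] at this
  exact ⟨p, this p hp, hab⟩

theorem isMem_map_iff (a b : 𝕌.Elem) : IsMem (j a) (j b) ↔ IsMem a b := by
  have h := j.map_formula (SetFormula.mem (.inl a) (.inl b) : setLanguage.Formula 𝕌.Elem) id
  simpa [Formula.Realize] using h

theorem pairMem_map_iff (a b g : 𝕌.Elem) : PairMem (j a) (j b) (j g) ↔ PairMem a b g := by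
  have h := j.map_formula
    (SetFormula.pairMem (.inl a) (.inl b) (.inl g) : setLanguage.Formula 𝕌.Elem) id
  simpa [Formula.Realize] using h

/-- A reflexive relation has a reflexive extension. -/
theorem pairMem_self_of_forall {A R : 𝕌.Elem} (h : ∀ t, IsMem t A → PairMem t t R) {t : N}
    (ht : IsMem t (j A)) : PairMem t t (j R) := by
  have e := j.map_formula (∀' (SetFormula.mem SetFormula.new (SetFormula.up (.inl A)) ⟹
    SetFormula.pairMem SetFormula.new SetFormula.new (SetFormula.up (.inl R))) :
      setLanguage.Formula 𝕌.Elem) id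
  simp only [Formula.Realize, BoundedFormula.realize_all, BoundedFormula.realize_imp,
    SetFormula.realize_mem, SetFormula.realize_pairMem, SetFormula.val_new, SetFormula.val_up,
    Sum.elim_inl, Function.comp_apply, id] at e
  exact e.2 h t ht

end Transfer

/-! ### Codes in the standard universe -/

section Codes

variable {𝕌 : StandardUniverse.{u}} {α : Type*} {β : Type*}

theorem isPair_iff_eq_pair (p a b : 𝕌.Elem) : IsPair p a b ↔ p.1 = ZFSet.pair a.1 b.1 := by
  have single : ∀ z : 𝕌.Elem, (∀ y, IsMem y z ↔ y = a) ↔ z.1 = {a.1} := by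
    intro z
    constructor
    · intro h
      ext y
      rw [ZFSet.mem_singleton]
      constructor
      · intro hy
        exact congrArg Subtype.val ((h ⟨y, 𝕌.mem_of_mem _ z.2 _ hy⟩).1 hy)
      · rintro rfl
        exact (h a).2 rfl
    · intro h y
      rw [isMem_iff_mem, h, ZFSet.mem_singleton]
      exact Subtype.ext_iff.symm
  have double : ∀ z : 𝕌.Elem, (∀ y, IsMem y z ↔ y = a ∨ y = b) ↔ z.1 = {a.1, b.1} := by
    intro z
    constructor
    · intro h
      ext y
      rw [ZFSet.mem_pair]
      constructor
      · intro hy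
        exact ((h ⟨y, 𝕌.mem_of_mem _ z.2 _ hy⟩).1 hy).imp (congrArg Subtype.val)
          (congrArg Subtype.val)
      · rintro (rfl | rfl)
        · exact (h a).2 (.inl rfl)
        · exact (h b).2 (.inr rfl)
    · intro h y
      rw [isMem_iff_mem, h, ZFSet.mem_pair]
      exact (or_congr Subtype.ext_iff Subtype.ext_iff).symm
  simp only [IsPair, single, double]
  constructor
  · intro h
    ext z
    rw [ZFSet.pair, ZFSet.mem_pair]
    constructor
    · intro hz
      exact (h ⟨z, 𝕌.mem_of_mem _ p.2 _ hz⟩).1 hz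
    · intro hz
      have hz' : z ∈ 𝕌.carrier := by
        rcases hz with rfl | rfl
        · have := 𝕌.pair_mem _ a.2 _ a.2
          rwa [show ({a.1, a.1} : ZFSet) = {a.1} by ext; simp] at this
        · exact 𝕌.pair_mem _ a.2 _ b.2
      exact (h ⟨z, hz'⟩).2 hz
  · intro h z
    rw [isMem_iff_mem, h, ZFSet.pair, ZFSet.mem_pair]

namespace Coding

theorem point_injective (c : Coding 𝕌 α) : Function.Injective c.point := fun _ _ h =>
  c.injective (congrArg Subtype.val h)

theorem isMem_set_iff (c : Coding 𝕌 α) (S : Set α) (z : 𝕌.Elem) :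
    IsMem z (c.set S) ↔ ∃ a ∈ S, c.point a = z := by
  refine (c.isMem_set_iff_val S z).trans ⟨?_, ?_⟩
  · rintro ⟨-, a, ha, e⟩
    exact ⟨a, ha, Subtype.ext e⟩
  · rintro ⟨a, ha, rfl⟩
    exact ⟨(c.mem_carrier _).2 ⟨a, rfl⟩, a, ha, rfl⟩

theorem pairMem_rel_iff (c : Coding 𝕌 α) (d : Coding 𝕌 β) (R : α → β → Prop) (a : α) (b : β) :
    PairMem (c.point a) (d.point b) (c.rel d R) ↔ R a b := by
  constructor
  · rintro ⟨p, hp, hab⟩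
    obtain ⟨-, a', b', h, e⟩ := (c.isMem_rel_iff_val d R p).1 hp
    rw [isPair_iff_eq_pair] at hab
    obtain ⟨ha, hb⟩ := ZFSet.pair_injective (e.trans hab)
    rwa [← c.injective ha, ← d.injective hb]
  · intro h
    have hp : ZFSet.pair (c.toFun a) (d.toFun b) ∈ ZFSet.prod c.carrier d.carrier :=
      ZFSet.pair_mem_prod.2 ⟨(c.mem_carrier _).2 ⟨a, rfl⟩, (d.mem_carrier _).2 ⟨b, rfl⟩⟩
    exact ⟨⟨_, 𝕌.mem_of_mem _ (𝕌.prod_mem c.carrier_mem d.carrier_mem) _ hp⟩,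
      (c.isMem_rel_iff_val d R _).2 ⟨hp, a, b, h, rfl⟩, (isPair_iff_eq_pair _ _ _).2 rfl⟩

end Coding

end Codes

/-! ### Fine paths and chains in a uniform space -/

/-- The map `f : [0, T] → X` goes from `x` to `y` and takes `W`-close times to `V`-close points. -/
structure IsFinePath {X : Type*} (W : Set (ℝ × ℝ)) (V : Set (X × X)) (T : ℝ) (x y : X)
    (f : ℝ → X) : Prop where
  source : f 0 = x
  target : f T = y
  fine : ∀ s ∈ Icc 0 T, ∀ t ∈ Icc 0 T, (s, t) ∈ W → (f s, f t) ∈ V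

/-- The times at distance less than `1`. -/
def unitEntourage : Set (ℝ × ℝ) := {p | dist p.1 p.2 < 1}

theorem unitEntourage_mem_uniformity : unitEntourage ∈ 𝓤 ℝ :=
  Metric.dist_mem_uniformity one_pos

/-- A chain is a step function, constant on the intervals `[k, k + 1)`. -/
theorem IsChainFromTo.exists_isFinePath {X : Type*} {V : Set (X × X)}
    (hrefl : ∀ x, (x, x) ∈ V) (hsymm : ∀ x y, (x, y) ∈ V → (y, x) ∈ V) {x y : X} {l : List X}
    (hl : IsChainFromTo V x y l) :
    ∃ f, IsFinePath unitEntourage V ((l.length - 1 : ℕ) : ℝ) x y f := by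
  obtain ⟨hchain, hx, hy⟩ := hl
  have hstep := List.isChain_iff_getElem.1 hchain
  have key : ∀ m n : ℕ, m ≤ n → n ≤ m + 1 → n ≤ l.length - 1 →
      (l.getD m x, l.getD n x) ∈ V := by
    intro m n h1 h2 h3
    obtain rfl | rfl : n = m ∨ n = m + 1 := by omega
    · exact hrefl _
    · have h : m + 1 < l.length := by omega
      rw [List.getD_eq_getElem _ _ h, List.getD_eq_getElem _ _ (by omega)]
      exact hstep m h
  refine ⟨fun t => l.getD ⌊t⌋₊ x, ?_, ?_, ?_⟩
  · cases l <;> simp_all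
  · cases l with
    | nil => simp at hx
    | cons a l =>
      rw [List.getLast?_eq_some_getLast (List.cons_ne_nil a l), Option.some_inj] at hy
      rw [← hy, Nat.floor_natCast, List.getD_eq_getElem _ _ (by simp), List.getLast_eq_getElem]
  · have main : ∀ s t : ℝ, 0 ≤ s → s ≤ t → t ≤ ((l.length - 1 : ℕ) : ℝ) → t < s + 1 →
        (l.getD ⌊s⌋₊ x, l.getD ⌊t⌋₊ x) ∈ V := by
      intro s t hs hst ht h1
      refine key _ _ (Nat.floor_mono hst) ?_ (Nat.floor_le_of_le ht)
      rw [← Nat.floor_add_one hs]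
      exact Nat.floor_mono h1.le
    intro s hs t ht hst
    have hst' := abs_lt.1 (show |s - t| < 1 from hst)
    rcases le_total s t with h | h
    · exact main s t hs.1 h ht.2 (by linarith)
    · exact hsymm _ _ (main t s ht.1 h hs.2 (by linarith))

/-- Sampling fine paths at sufficiently close times yields chains, of a length that depends only
on the length of the interval and the fineness. -/
theorem exists_length_of_isFinePath {X : Type*} {W : Set (ℝ × ℝ)} (hW : W ∈ 𝓤 ℝ) {T : ℝ}
    (hT : 0 ≤ T) : ∃ n : ℕ, ∀ (V : Set (X × X)) (x y : X) (f : ℝ → X), IsFinePath W V T x y f →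
      ∃ l : List X, l.length = n ∧ IsChainFromTo V x y l := by
  obtain ⟨δ, hδ, hδW⟩ := Metric.mem_uniformity_dist.1 hW
  obtain ⟨n, hn⟩ := exists_nat_gt (T / δ)
  have hn0 : (0 : ℝ) < n := lt_of_le_of_lt (by positivity) hn
  have hstep : T / n < δ := by
    rw [div_lt_iff₀ hδ] at hn
    rw [div_lt_iff₀ hn0]
    linarith
  refine ⟨n + 1, fun V x y f hf => ⟨(List.range (n + 1)).map fun k : ℕ => f (k * (T / n)),
    by simp, ?_, ?_, ?_⟩⟩
  · rw [List.isChain_map, List.isChain_range_succ]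
    intro k hk
    have hmem : ∀ m : ℕ, m ≤ n → (m : ℝ) * (T / n) ∈ Icc 0 T := by
      intro m hm
      refine ⟨by positivity, ?_⟩
      rw [mul_div_assoc', div_le_iff₀ hn0, mul_comm]
      exact mul_le_mul_of_nonneg_left (by exact_mod_cast hm) hT
    refine hf.fine _ (hmem k hk.le) _ (hmem (k + 1) hk) (hδW ?_)
    rw [Real.dist_eq, abs_sub_comm, abs_of_nonneg]
    · push_cast
      linarith
    · push_cast
      have : 0 ≤ T / n := by positivity
      linarith
  · simp [List.range_succ_eq_map, hf.source]
  · simp [List.range_succ, mul_div_cancel₀ T hn0.ne', hf.target]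

/-! ### Paths in the standard and in the nonstandard universe -/

section Paths

open FirstOrder.Language

variable {𝕌 : StandardUniverse.{u}} {X : Type v}

/-- The parameters for paths in `X`, on intervals of the real line, with codes read through `e`.
Here `e` is the identity for paths in the standard universe, the embedding `j` for paths in the
nonstandard universe, and the map to variables for formulas about paths. -/
noncomputable def pathData {M : Type*} (r : Coding 𝕌 ℝ) (c : Coding 𝕌 X) (e : 𝕌.Elem → M)
    (close fine : M) : PathData M :=
  ⟨e (r.set univ), e (r.point 0), e (r.rel r (· ≤ ·)), e (c.set univ), close, fine⟩

variable (r : Coding 𝕌 ℝ) (c : Coding 𝕌 X)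

theorem inInterval_pathData_iff (w v : 𝕌.Elem) (T : ℝ) (t : 𝕌.Elem) :
    (pathData r c id w v).InInterval (r.point T) t ↔ ∃ t' ∈ Icc 0 T, r.point t' = t := by
  simp only [PathData.InInterval, pathData, id]
  constructor
  · rintro ⟨ht, h0, hT⟩
    obtain ⟨t', -, rfl⟩ := (r.isMem_set_iff _ _).1 ht
    rw [Coding.pairMem_rel_iff] at h0 hT
    exact ⟨t', ⟨h0, hT⟩, rfl⟩
  · rintro ⟨t', ⟨h0, hT⟩, rfl⟩
    rw [Coding.pairMem_rel_iff, Coding.pairMem_rel_iff]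
    exact ⟨(r.isMem_set_iff _ _).2 ⟨t', mem_univ _, rfl⟩, h0, hT⟩

theorem joined_pathData_iff (W : Set (ℝ × ℝ)) (V : Set (X × X)) {T : ℝ} (hT : 0 ≤ T) (x y : X) :
    (pathData r c id (r.rel r fun s t => (s, t) ∈ W) (c.rel c fun a b => (a, b) ∈ V)).Joined
      (r.point T) (c.point x) (c.point y) ↔ ∃ f, IsFinePath W V T x y f := by
  have hmem : ∀ a : X, IsMem (c.point a) (c.set univ) := fun a =>
    (c.isMem_set_iff _ _).2 ⟨a, mem_univ _, rfl⟩
  constructor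
  · rintro ⟨-, -, g, ⟨hg, hfine⟩, h0, hT'⟩
    have hval : ∀ t : ℝ, ∃ a : X, t ∈ Icc 0 T →
        ∀ b, PairMem (r.point t) (c.point b) g ↔ b = a := by
      intro t
      by_cases ht : t ∈ Icc 0 T
      · obtain ⟨b, hb, hb'⟩ := hg _ ((inInterval_pathData_iff r c _ _ T _).2 ⟨t, ht, rfl⟩)
        obtain ⟨a, -, rfl⟩ := (c.isMem_set_iff _ _).1 hb
        exact ⟨a, fun _ b => (hb' _ (hmem b)).trans c.point_injective.eq_iff⟩
      · exact ⟨x, fun h => absurd h ht⟩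
    choose f hf using hval
    refine ⟨f, ((hf 0 ⟨le_rfl, hT⟩ x).1 h0).symm, ((hf T ⟨hT, le_rfl⟩ y).1 hT').symm, ?_⟩
    intro s hs t ht hst
    have hclose := (r.pairMem_rel_iff r (fun s t => (s, t) ∈ W) s t).2 hst
    have := hfine (r.point s) (r.point t) ((inInterval_pathData_iff r c _ _ T _).2 ⟨s, hs, rfl⟩)
      ((inInterval_pathData_iff r c _ _ T _).2 ⟨t, ht, rfl⟩) hclose (c.point (f s)) (c.point (f t))
      (hmem _) (hmem _) ((hf s hs (f s)).2 rfl) ((hf t ht (f t)).2 rfl)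
    exact (c.pairMem_rel_iff c (fun a b => (a, b) ∈ V) (f s) (f t)).1 this
  · rintro ⟨f, rfl, rfl, hf⟩
    refine ⟨hmem _, hmem _, r.rel c fun t a => f t = a, ⟨?_, ?_⟩,
      (r.pairMem_rel_iff c (fun t a => f t = a) 0 (f 0)).2 rfl,
      (r.pairMem_rel_iff c (fun t a => f t = a) T (f T)).2 rfl⟩
    · intro t ht
      obtain ⟨t, -, rfl⟩ := (inInterval_pathData_iff r c _ _ T _).1 ht
      refine ⟨c.point (f t), hmem _, fun b hb => ?_⟩
      obtain ⟨b, -, rfl⟩ := (c.isMem_set_iff _ _).1 hb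
      rw [Coding.pairMem_rel_iff, c.point_injective.eq_iff]
      exact eq_comm
    · intro s t hs ht hst a b ha hb hsa htb
      obtain ⟨s, hs', rfl⟩ := (inInterval_pathData_iff r c _ _ T _).1 hs
      obtain ⟨t, ht', rfl⟩ := (inInterval_pathData_iff r c _ _ T _).1 ht
      obtain ⟨a, -, rfl⟩ := (c.isMem_set_iff _ _).1 ha
      obtain ⟨b, -, rfl⟩ := (c.isMem_set_iff _ _).1 hb
      rw [Coding.pairMem_rel_iff] at hsa htb
      subst hsa htb
      have hclose := (r.pairMem_rel_iff r (fun s t => (s, t) ∈ W) s t).1 hst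
      exact (c.pairMem_rel_iff c (fun a b => (a, b) ∈ V) (f s) (f t)).2 (hf s hs' t ht' hclose)

theorem exists_nonneg_iff (p : 𝕌.Elem → Prop) :
    (∃ T, (IsMem T (r.set univ) ∧ PairMem (r.point 0) T (r.rel r (· ≤ ·))) ∧ p T) ↔
      ∃ T : ℝ, 0 ≤ T ∧ p (r.point T) := by
  constructor
  · rintro ⟨T, ⟨hT, h0⟩, h⟩
    obtain ⟨T, -, rfl⟩ := (r.isMem_set_iff _ _).1 hT
    exact ⟨T, (Coding.pairMem_rel_iff _ _ _ _ _).1 h0, h⟩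
  · rintro ⟨T, h0, h⟩
    exact ⟨_, ⟨(r.isMem_set_iff _ _).2 ⟨T, mem_univ _, rfl⟩,
      (Coding.pairMem_rel_iff _ _ _ _ _).2 h0⟩, h⟩

theorem forall_isMem_set_iff {α : Type*} (c : Coding 𝕌 α) (B : Set α) (p : 𝕌.Elem → Prop) :
    (∀ x, IsMem x (c.set B) → p x) ↔ ∀ x ∈ B, p (c.point x) := by
  simp only [Coding.isMem_set_iff]
  exact ⟨fun h x hx => h _ ⟨x, hx, rfl⟩, by rintro h _ ⟨x, hx, rfl⟩; exact h x hx⟩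

theorem uniformlyJoined_pathData_iff (W : Set (ℝ × ℝ)) (V : Set (X × X)) (B : Set X) :
    (pathData r c id (r.rel r fun s t => (s, t) ∈ W)
      (c.rel c fun a b => (a, b) ∈ V)).UniformlyJoined (c.set B) ↔
      ∃ T : ℝ, 0 ≤ T ∧ ∀ x ∈ B, ∀ y ∈ B, ∃ f, IsFinePath W V T x y f := by
  refine (exists_nonneg_iff r _).trans (exists_congr fun T => and_congr_right fun hT => ?_)
  simp only [forall_isMem_set_iff, joined_pathData_iff r c W V hT]

theorem pointwiseJoined_pathData_iff (W : Set (ℝ × ℝ)) (V : Set (X × X)) (B : Set X) :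
    (pathData r c id (r.rel r fun s t => (s, t) ∈ W)
      (c.rel c fun a b => (a, b) ∈ V)).PointwiseJoined (c.set B) ↔
      ∀ x ∈ B, ∀ y ∈ B, ∃ T : ℝ, 0 ≤ T ∧ ∃ f, IsFinePath W V T x y f := by
  simp only [PathData.PointwiseJoined, forall_isMem_set_iff]
  refine forall₄_congr fun x _ y _ => (exists_nonneg_iff r _).trans ?_
  exact exists_congr fun T => and_congr_right fun hT => joined_pathData_iff r c W V hT x y

variable {N : Type w} [setLanguage.Structure N] (j : 𝕌.Elem ↪ₑ[setLanguage] N)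

theorem zero_mem_hyperInterval {T : N} (hT : T ∈ nonnegHyperreals j r) :
    j (r.point 0) ∈ hyperInterval j r T :=
  ⟨(isMem_map_iff j _ _).2 ((r.isMem_set_iff _ _).2 ⟨0, mem_univ _, rfl⟩),
    (pairMem_map_iff j _ _ _).2 ((Coding.pairMem_rel_iff _ _ _ _ _).2 le_rfl), hT.2⟩

theorem self_mem_hyperInterval {T : N} (hT : T ∈ nonnegHyperreals j r) :
    T ∈ hyperInterval j r T := by
  refine ⟨hT.1, hT.2, pairMem_self_of_forall j ?_ hT.1⟩
  exact (forall_isMem_set_iff r _ _).2 fun t _ => (Coding.pairMem_rel_iff _ _ _ _ _).2 le_rfl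

variable {r c j} [UniformSpace X]

/-- A path that takes times at distance less than `1` to points related by an infinitesimal
relation is S-continuous. -/
theorem exists_isSPath_of_joined {v : N} (hv : ∀ a b, PairMem a b v → InfClose j c a b)
    {T x y : N} (hT : T ∈ nonnegHyperreals j r)
    (h : (pathData r c j (j (r.rel r fun s t => (s, t) ∈ unitEntourage)) v).Joined T x y) :
    ∃ γ : N → N, IsSPath j r c T x y γ := by
  obtain ⟨hx, hy, g, ⟨hg, hfine⟩, h0, hT'⟩ := h
  have hval : ∀ t : N, ∃ b, t ∈ hyperInterval j r T → b ∈ starSet j c univ ∧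
      ∀ b' ∈ starSet j c univ, PairMem t b' g ↔ b' = b := by
    intro t
    by_cases ht : t ∈ hyperInterval j r T
    · obtain ⟨b, hb⟩ := hg t ht
      exact ⟨b, fun _ => hb⟩
    · exact ⟨t, fun h => absurd h ht⟩
  choose γ hγ using hval
  have hself : ∀ t ∈ hyperInterval j r T, PairMem t (γ t) g := fun t ht =>
    ((hγ t ht).2 _ (hγ t ht).1).2 rfl
  refine ⟨γ, fun t ht => (hγ t ht).1, ⟨g, fun t ht b hb => ((hγ t ht).2 b hb).trans eq_comm⟩,
    fun s hs t ht hst => hv _ _ ?_, ?_, ?_⟩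
  · exact hfine s t hs ht (hst _ unitEntourage_mem_uniformity) _ _ (hγ s hs).1 (hγ t ht).1
      (hself s hs) (hself t ht)
  · exact (((hγ _ (zero_mem_hyperInterval r j hT)).2 x hx).1 h0).symm
  · exact (((hγ _ (self_mem_hyperInterval r j hT)).2 y hy).1 hT').symm

/-- An S-continuous path takes times related by an infinitesimal relation to points related by the
extension of any given entourage. -/
theorem joined_of_isSPath {w : N} (hw : ∀ s t, PairMem s t w → InfClose j r s t)
    {V : Set (X × X)} (hV : V ∈ 𝓤 X) {T x y : N} (hT : T ∈ nonnegHyperreals j r) {γ : N → N}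
    (h : IsSPath j r c T x y γ) :
    (pathData r c j w (j (c.rel c fun a b => (a, b) ∈ V))).Joined T x y := by
  obtain ⟨hmaps, ⟨g, hg⟩, hcont, rfl, rfl⟩ := h
  have h0 := zero_mem_hyperInterval r j hT
  have h1 := self_mem_hyperInterval r j hT
  refine ⟨hmaps h0, hmaps h1, g, ⟨fun t ht => ⟨γ t, hmaps ht, fun b hb =>
    (hg t ht b hb).trans eq_comm⟩, ?_⟩, (hg _ h0 _ (hmaps h0)).2 rfl, (hg _ h1 _ (hmaps h1)).2 rfl⟩
  intro s t hs ht hst a b ha hb hsa htb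
  rw [← (hg s hs a ha).1 hsa, ← (hg t ht b hb).1 htb]
  exact hcont s hs t ht (hw s t hst) V hV

end Paths

/-! ### Boundedness and connectedness by fine paths -/

section Standard

variable {X : Type*} [UniformSpace X]

theorem IsHuBounded.exists_isFinePath {B : Set X} (hB : IsHuBounded B) {V : Set (X × X)}
    (hV : V ∈ 𝓤 X) :
    ∃ T : ℝ, 0 ≤ T ∧ ∀ x ∈ B, ∀ y ∈ B, ∃ f, IsFinePath unitEntourage V T x y f := by
  obtain ⟨V', hV', hsymm, hsub⟩ := symm_of_uniformity hV
  obtain ⟨n, hn⟩ := hB V' hV'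
  -- If `n = 0`, then there are no chains of length `n`, so `B` is empty and `T` does not matter.
  refine ⟨((n - 1 : ℕ) : ℝ), Nat.cast_nonneg _, fun x hx y hy => ?_⟩
  obtain ⟨l, rfl, hl⟩ := hn x hx y hy
  obtain ⟨f, h0, hT, hf⟩ := hl.exists_isFinePath (fun _ => refl_mem_uniformity hV') hsymm.symm
  exact ⟨f, h0, hT, fun s hs t ht hst => hsub (hf s hs t ht hst)⟩

theorem IsChainConnected.exists_isFinePath (h : IsChainConnected X) {V : Set (X × X)}
    (hV : V ∈ 𝓤 X) (x y : X) : ∃ T : ℝ, 0 ≤ T ∧ ∃ f, IsFinePath unitEntourage V T x y f := by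
  obtain ⟨V', hV', hsymm, hsub⟩ := symm_of_uniformity hV
  obtain ⟨l, hl⟩ := h V' hV' x y
  obtain ⟨f, h0, hT, hf⟩ := hl.exists_isFinePath (fun _ => refl_mem_uniformity hV') hsymm.symm
  exact ⟨_, Nat.cast_nonneg _, f, h0, hT, fun s hs t ht hst => hsub (hf s hs t ht hst)⟩

end Standard

/-! ### The nonstandard characterizations -/

section Characterizations

open FirstOrder.Language

variable {𝕌 : StandardUniverse.{u}} {N : Type w} [setLanguage.Structure N]
  {j : 𝕌.Elem ↪ₑ[setLanguage] N} {r : Coding 𝕌 ℝ} {X : Type v} [UniformSpace X] {c : Coding 𝕌 X}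

theorem isSBounded_of_isHuBounded (hN : IsSaturated setLanguage (Order.succ #𝕌.Elem) N)
    {B : Set X} (hB : IsHuBounded B) : IsSBounded j r c B := by
  obtain ⟨v, hv, hinf⟩ := exists_infinitesimal_relation j hN c
    (SetFormula.uniformlyJoined (pathData r c (fun a => .inl (.inl a))
      (.inl (.inl (r.rel r fun s t => (s, t) ∈ unitEntourage))) (.inl (.inr ())))
      (.inl (.inl (c.set B)))) fun V hV =>
      SetFormula.realize_uniformlyJoined.2
        ((uniformlyJoined_pathData_iff r c unitEntourage V B).2 (hB.exists_isFinePath hV))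
  obtain ⟨T, hT, h⟩ := SetFormula.realize_uniformlyJoined.1 hv
  exact ⟨T, hT, fun x hx y hy => exists_isSPath_of_joined hinf hT (h x hx y hy)⟩

theorem isHuBounded_of_isSBounded (hN : IsSaturated setLanguage (Order.succ #𝕌.Elem) N)
    {B : Set X} (hB : IsSBounded j r c B) : IsHuBounded B := by
  intro V hV
  obtain ⟨W, hW, T, hT, h⟩ : ∃ W ∈ 𝓤 ℝ, ∃ T : ℝ, 0 ≤ T ∧ ∀ x ∈ B, ∀ y ∈ B,
      ∃ f, IsFinePath W V T x y f := by
    by_contra! hcon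
    obtain ⟨w, hw, hinf⟩ := exists_infinitesimal_relation j hN r
      (SetFormula.uniformlyJoined (pathData r c (fun a => .inl (.inl a)) (.inl (.inr ()))
        (.inl (.inl (c.rel c fun a b => (a, b) ∈ V)))) (.inl (.inl (c.set B)))).not
      fun W hW => BoundedFormula.realize_not.2 fun hR => by
        obtain ⟨T, hT, h⟩ := (uniformlyJoined_pathData_iff r c W V B).1
          (SetFormula.realize_uniformlyJoined.1 hR)
        obtain ⟨x, hx, y, hy, hf⟩ := hcon W hW T hT
        obtain ⟨f, hf'⟩ := h x hx y hy
        exact hf f hf'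
    obtain ⟨T, hT, h⟩ := hB
    refine BoundedFormula.realize_not.1 hw (SetFormula.realize_uniformlyJoined.2
      ⟨T, hT, fun x hx y hy => ?_⟩)
    obtain ⟨γ, hγ⟩ := h x hx y hy
    exact joined_of_isSPath hinf hV hT hγ
  obtain ⟨n, hn⟩ := exists_length_of_isFinePath hW hT
  refine ⟨n, fun x hx y hy => ?_⟩
  obtain ⟨f, hf⟩ := h x hx y hy
  exact hn V x y f hf

theorem isSInftyConnected_of_isChainConnected
    (hN : IsSaturated setLanguage (Order.succ #𝕌.Elem) N) (hX : IsChainConnected X) :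
    IsSInftyConnected j r c := by
  obtain ⟨v, hv, hinf⟩ := exists_infinitesimal_relation j hN c
    (SetFormula.pointwiseJoined (pathData r c (fun a => .inl (.inl a))
      (.inl (.inl (r.rel r fun s t => (s, t) ∈ unitEntourage))) (.inl (.inr ())))
      (.inl (.inl (c.set univ)))) fun V hV =>
      SetFormula.realize_pointwiseJoined.2
        ((pointwiseJoined_pathData_iff r c unitEntourage V univ).2
          fun x _ y _ => hX.exists_isFinePath hV x y)
  intro x hx y hy
  obtain ⟨T, hT, h⟩ := SetFormula.realize_pointwiseJoined.1 hv x hx y hy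
  exact ⟨T, hT, exists_isSPath_of_joined hinf hT h⟩

theorem isChainConnected_of_isSInftyConnected
    (hN : IsSaturated setLanguage (Order.succ #𝕌.Elem) N) (hX : IsSInftyConnected j r c) :
    IsChainConnected X := by
  intro V hV x y
  -- The formula quantifies over all points, although two of them are fixed: it is the one that
  -- `S_∞`-connectedness satisfies as it stands.
  obtain ⟨W, hW, T, hT, f, hf⟩ : ∃ W ∈ 𝓤 ℝ, ∃ T : ℝ, 0 ≤ T ∧ ∃ f, IsFinePath W V T x y f := by
    by_contra! hcon
    obtain ⟨w, hw, hinf⟩ := exists_infinitesimal_relation j hN r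
      (SetFormula.pointwiseJoined (pathData r c (fun a => .inl (.inl a)) (.inl (.inr ()))
        (.inl (.inl (c.rel c fun a b => (a, b) ∈ V)))) (.inl (.inl (c.set univ)))).not
      fun W hW => BoundedFormula.realize_not.2 fun hR => by
        obtain ⟨T, hT, f, hf⟩ := (pointwiseJoined_pathData_iff r c W V univ).1
          (SetFormula.realize_pointwiseJoined.1 hR) x (mem_univ x) y (mem_univ y)
        exact hcon W hW T hT f hf
    refine BoundedFormula.realize_not.1 hw (SetFormula.realize_pointwiseJoined.2 fun x hx y hy => ?_)
    obtain ⟨T, hT, γ, hγ⟩ := hX x hx y hy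
    exact ⟨T, hT, joined_of_isSPath hinf hV hT hγ⟩
  obtain ⟨n, hn⟩ := exists_length_of_isFinePath hW hT
  obtain ⟨l, -, hl⟩ := hn V x y f hf
  exact ⟨l, hl⟩

end Characterizations

theorem mainTheorem10 (𝕌 : StandardUniverse.{u}) (N : Type w) [setLanguage.Structure N]
    (j : 𝕌.Elem ↪ₑ[setLanguage] N) (hN : IsSaturated setLanguage (Order.succ #𝕌.Elem) N)
    (r : Coding 𝕌 ℝ) (X : Type v) [UniformSpace X] (c : Coding 𝕌 X) :
    (IsHuBounded (univ : Set X) ↔ IsSConnected j r c) ∧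
      (∀ B : Set X, IsHuBounded B ↔ IsSBounded j r c B) ∧
      (IsChainConnected X ↔ IsSInftyConnected j r c) :=
  have h (B : Set X) : IsHuBounded B ↔ IsSBounded j r c B :=
    ⟨isSBounded_of_isHuBounded hN, isHuBounded_of_isSBounded hN⟩
  -- `X` is S-connected exactly when its subset `univ` is S-bounded, by definition.
  ⟨h univ, h, isSInftyConnected_of_isChainConnected hN, isChainConnected_of_isSInftyConnected hN⟩
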